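/- Let $m\ge 2$ and $n\ge 1$, and let $A=(a_{i_1\cdots i_m})_{1\le i_1,\dots,i_m\le n}$ be a tensor of order $m$ and rank $n$ with entries in $\mathbb R\cup\{\infty\}$. For $i=1,\dots,n$ let $$S_i=\{\{i_2,\dots,i_m\} : a_{i i_2\cdots i_m}\neq\infty\},$$ where $\{i_2,\dots,i_m\}$ denotes a multiset. Call $\lambda\in\mathbb R$ a tropical H-eigenvalue of $A$ if there is $x\in\mathbb R^n/\mathbb R(1,\dots,1)$ such that $$\min_{1\le i_2,\dots,i_m\le n}\bigl(a_{i i_2\cdots i_m}+x_{i_2}+\cdots+x_{i_m}\bigr)=\lambda+(m-1)x_i\qquad (i=1,\dots,n);$$ this condition does not depend on the representative of $x$ in $\mathbb R^n$. Assume that all the sets $S_i$ are nonempty and that $S_1=\cdots=S_n$. Then $A$ has exactly one tropical H-eigenvalue $\lambda(A)\in\mathbb R$. -/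

import Mathlib

/-- A tensor of order `m` and rank `n` with entries in `ℝ ∪ {∞}`: the entry `a_{i i₂ ⋯ i_m}` is
`A i J`, where `J = (i₂, …, i_m)` is a tuple of `m - 1` indices. -/
abbrev ExtTensor (m n : ℕ) : Type := Fin n → (Fin (m - 1) → Fin n) → WithTop ℝ

/-- A real number as an element of the tropical (min-plus) semiring `ℝ ∪ {∞}`. -/
abbrev tropReal (r : ℝ) : Tropical (WithTop ℝ) := Tropical.trop (r : WithTop ℝ)

/-- The set `S_i` of multisets `{i₂, …, i_m}` for which `a_{i i₂ ⋯ i_m} ≠ ∞`. -/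
def tensorSupport {m n : ℕ} (A : ExtTensor m n) (i : Fin n) : Set (Multiset (Fin n)) :=
  {M | ∃ J : Fin (m - 1) → Fin n, A i J ≠ ⊤ ∧ M = Finset.univ.val.map J}

/-- The tropical H-eigenpair equations for a vector `v ∈ ℝⁿ`:
`⨁_{i₂, …, i_m} a_{i i₂ ⋯ i_m} ⊙ v_{i₂} ⊙ ⋯ ⊙ v_{i_m} = lam ⊙ v_i^{m-1}` for all `i`.
All operations are those of the tropical semiring: `+` is the minimum and `*` is addition. -/
def HEigenEquations {m n : ℕ} (A : ExtTensor m n) (v : Fin n → ℝ) (lam : ℝ) : Prop :=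
  ∀ i : Fin n,
    ∑ J : Fin (m - 1) → Fin n, Tropical.trop (A i J) * ∏ k, tropReal (v (J k)) =
      tropReal lam * tropReal (v i) ^ (m - 1)

/-- Tropical projective torus `ℝⁿ / ℝ(1, …, 1)`. -/
abbrev TropicalTorus (n : ℕ) : Type :=
  (Fin n → ℝ) ⧸ Submodule.span ℝ ({fun _ => 1} : Set (Fin n → ℝ))

theorem HEigenEquations.shift {m n : ℕ} {A : ExtTensor m n} {v : Fin n → ℝ} {lam : ℝ}
    (h : HEigenEquations A v lam) (c : ℝ) : HEigenEquations A (fun i => c + v i) lam := by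
  intro i
  have e : ∀ j, tropReal (c + v j) = tropReal c * tropReal (v j) := fun j => rfl
  simp only [e, Finset.prod_mul_distrib, Finset.prod_const, Finset.card_univ, Fintype.card_fin,
    mul_pow]
  rw [mul_left_comm, ← h i, Finset.mul_sum]
  exact Finset.sum_congr rfl fun J _ => mul_left_comm _ _ _

theorem hEigenEquations_congr {m n : ℕ} (A : ExtTensor m n) (lam : ℝ) (v w : Fin n → ℝ)
    (h : v - w ∈ Submodule.span ℝ ({fun _ => 1} : Set (Fin n → ℝ))) :
    HEigenEquations A v lam ↔ HEigenEquations A w lam := by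
  obtain ⟨c, hc⟩ := Submodule.mem_span_singleton.1 h
  have hc' : ∀ i, c = v i - w i := fun i => by simpa using congrFun hc i
  constructor
  · intro hv
    convert hv.shift (-c) using 2 with i
    rw [hc' i]; ring
  · intro hw
    convert hw.shift c using 2 with i
    rw [hc' i]; ring

/-- `(x, lam)` is a tropical H-eigenpair of `A`, where `x ∈ ℝⁿ / ℝ(1, …, 1)`; the equations do not
depend on the representative of `x`. -/
def IsTropicalHEigenpair {m n : ℕ} (A : ExtTensor m n) (x : TropicalTorus n) (lam : ℝ) : Prop :=
  Quotient.liftOn' x (fun v => HEigenEquations A v lam) fun v w h =>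
    propext (hEigenEquations_congr A lam v w ((Submodule.quotientRel_def _).1 h))

/-- `lam ∈ ℝ` is a tropical H-eigenvalue of `A`. -/
def IsTropicalHEigenvalue {m n : ℕ} (A : ExtTensor m n) (lam : ℝ) : Prop :=
  ∃ x : TropicalTorus n, IsTropicalHEigenpair A x lam

/-! Write F(v)_i for the minimum in row i. F is monotone and additively homogeneous of degree m - 1,
so comparing two eigenvectors where their difference is maximal gives uniqueness. For existence, G =
F/(m - 1) is sup-norm nonexpansive. Equal supports bound the oscillation of F(v) uniformly in v,
which keeps the normalised fixed points of the contractions G/(1 + ε) in a compact set; a limit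
point as ε → 0 is an eigenvector (vanishing discount). -/

open Filter Topology in
/-- A monotone, additively homogeneous self-map of `ℝ^ι` whose image has bounded oscillation
has an additive eigenvector. -/
theorem exists_additive_eigenvector {ι : Type*} [Fintype ι] [Nonempty ι]
    (G : (ι → ℝ) → ι → ℝ)
    (hG : ∀ (v w : ι → ℝ) (c : ℝ), (∀ i, v i ≤ w i + c) → ∀ i, G v i ≤ G w i + c)
    (C : ℝ) (hC : ∀ v i j, G v i ≤ G v j + C) :
    ∃ (lam : ℝ) (v : ι → ℝ), ∀ i, G v i = lam + v i := by
  obtain ⟨o⟩ := ‹Nonempty ι›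
  have hC0 : 0 ≤ C := by linarith [hC 0 o o]
  have hlip : LipschitzWith 1 G := by
    refine LipschitzWith.of_dist_le_mul fun v w => ?_
    rw [NNReal.coe_one, one_mul]
    have key : ∀ v w : ι → ℝ, ∀ i, G v i ≤ G w i + dist v w := fun v w => hG v w _ fun i => by
      have := (le_abs_self _).trans ((Real.dist_eq (v i) (w i)).symm.le.trans (dist_le_pi_dist v w i))
      linarith
    refine (dist_pi_le_iff dist_nonneg).2 fun i => ?_
    rw [Real.dist_eq, abs_le]
    have h₁ := key v w i
    have h₂ := key w v i
    rw [dist_comm] at h₂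
    constructor <;> linarith
  have hfix : ∀ ε : ℝ, 0 < ε → ∃ x : ι → ℝ, ∀ i, G x i = (1 + ε) * x i := by
    intro ε hε
    have hpos : 0 < 1 + ε := by linarith
    let K : NNReal := (1 + ε.toNNReal)⁻¹
    have hKε : (K : ℝ) = (1 + ε)⁻¹ := by simp [K, hε.le]
    have hK : K < 1 := by
      rw [← NNReal.coe_lt_coe, hKε]
      exact inv_lt_one_of_one_lt₀ (by linarith)
    have hcon : ContractingWith K fun x => (1 + ε)⁻¹ • G x := by
      refine ⟨hK, LipschitzWith.of_dist_le_mul fun v w => ?_⟩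
      rw [dist_smul₀, Real.norm_of_nonneg (by positivity), hKε]
      have := hlip.dist_le_mul v w
      rw [NNReal.coe_one, one_mul] at this
      exact mul_le_mul_of_nonneg_left this (by positivity)
    obtain ⟨x, hx⟩ : ∃ x, (1 + ε)⁻¹ • G x = x := ⟨_, hcon.fixedPoint_isFixedPt.eq⟩
    refine ⟨x, fun i => ?_⟩
    have h := congrFun hx i
    rw [Pi.smul_apply, smul_eq_mul] at h
    rw [← h, mul_inv_cancel_left₀ hpos.ne']
  have happrox : ∀ k : ℕ, ∃ y : ι → ℝ, y ∈ Metric.closedBall 0 C ∧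
      ∀ i, G y i - y i - (G y o - y o) = 1 / ((k : ℝ) + 1) * (y i - y o) := by
    intro k
    obtain ⟨x, hx⟩ := hfix (1 / ((k : ℝ) + 1)) (by positivity)
    have hε : 0 < 1 / ((k : ℝ) + 1) := by positivity
    set ε := 1 / ((k : ℝ) + 1)
    -- The fixed-point equation gives (1 + ε)(x i - x j) ≤ C, with C ≥ 0.
    have hosc : ∀ i j, x i - x j ≤ C := fun i j => by
      have := hC x i j
      rw [hx, hx] at this
      by_contra! hlt
      nlinarith
    have hshift : ∀ i, G (fun j => x j - x o) i = G x i - x o := fun i => by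
      have h₁ := hG (fun j => x j - x o) x (-x o) (fun j => by linarith) i
      have h₂ := hG x (fun j => x j - x o) (x o) (fun j => by linarith) i
      linarith
    refine ⟨fun j => x j - x o, ?_, fun i => ?_⟩
    · rw [mem_closedBall_zero_iff, pi_norm_le_iff_of_nonneg hC0]
      intro i
      rw [Real.norm_eq_abs, abs_le]
      constructor <;> linarith [hosc i o, hosc o i]
    · rw [hshift, hshift, hx, hx]
      ring
  choose y hy hyG using happrox
  obtain ⟨z, -, φ, hφ, hz⟩ := (isCompact_closedBall (0 : ι → ℝ) C).tendsto_subseq hy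
  have hzi : ∀ i, Tendsto (fun k => y (φ k) i) atTop (𝓝 (z i)) := tendsto_pi_nhds.1 hz
  have hGi : ∀ i, Tendsto (fun k => G (y (φ k)) i) atTop (𝓝 (G z i)) :=
    tendsto_pi_nhds.1 ((hlip.continuous.tendsto z).comp hz)
  -- In the limit, G z - z takes the same value at every coordinate as at o.
  refine ⟨G z o - z o, z, fun i => ?_⟩
  have h₁ := ((hGi i).sub (hzi i)).sub ((hGi o).sub (hzi o))
  have h₂ := ((tendsto_one_div_add_atTop_nhds_zero_nat (𝕜 := ℝ)).comp hφ.tendsto_atTop).mul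
    ((hzi i).sub (hzi o))
  have h₃ := tendsto_nhds_unique h₁ (h₂.congr fun k => (hyG (φ k) i).symm)
  linarith

/-- The additive eigenvalue of a monotone map that is additively homogeneous of degree `d` is unique. -/
theorem additive_eigenvalue_le {ι : Type*} [Finite ι] [Nonempty ι] {d : ℝ}
    (F : (ι → ℝ) → ι → ℝ)
    (hF : ∀ (v w : ι → ℝ) (c : ℝ), (∀ i, v i ≤ w i + c) → ∀ i, F v i ≤ F w i + d * c)
    {lam mu : ℝ} {v w : ι → ℝ} (hv : ∀ i, F v i = lam + d * v i) (hw : ∀ i, F w i = mu + d * w i) :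
    lam ≤ mu := by
  obtain ⟨i, hi⟩ := Finite.exists_max fun i => v i - w i
  have := hF v w (v i - w i) (fun j => by linarith [hi j]) i
  rw [hv, hw] at this
  linarith

namespace ExtTensor

variable {m n : ℕ} (A : ExtTensor m n)

/-- The value `min_{i₂, …, i_m} (a_{i i₂ ⋯ i_m} + v_{i₂} + ⋯ + v_{i_m})` in `ℝ ∪ {∞}`. -/
noncomputable def minValue (v : Fin n → ℝ) (i : Fin n) : WithTop ℝ :=
  Finset.univ.inf fun J => A i J + ((∑ k, v (J k) : ℝ) : WithTop ℝ)

theorem minValue_le (v : Fin n → ℝ) (i : Fin n) (J : Fin (m - 1) → Fin n) :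
    A.minValue v i ≤ A i J + ((∑ k, v (J k) : ℝ) : WithTop ℝ) :=
  Finset.inf_le (Finset.mem_univ J)

variable {A} in
theorem exists_minValue_eq {i : Fin n} (h : (tensorSupport A i).Nonempty) (v : Fin n → ℝ) :
    ∃ (J : Fin (m - 1) → Fin n) (a : ℝ), A i J = a ∧
      A.minValue v i = ((a + ∑ k, v (J k) : ℝ) : WithTop ℝ) := by
  obtain ⟨-, J₀, hJ₀, -⟩ := h
  obtain ⟨J, -, hJ⟩ := Finset.exists_mem_eq_inf Finset.univ ⟨J₀, Finset.mem_univ J₀⟩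
    fun J => A i J + ((∑ k, v (J k) : ℝ) : WithTop ℝ)
  have hle := A.minValue_le v i J₀
  rw [minValue, hJ] at hle
  have hne : A i J ≠ ⊤ := by
    intro htop
    rw [htop, top_add, top_le_iff] at hle
    exact WithTop.add_ne_top.2 ⟨hJ₀, WithTop.coe_ne_top⟩ hle
  obtain ⟨a, ha⟩ := WithTop.ne_top_iff_exists.1 hne
  refine ⟨J, a, ha.symm, ?_⟩
  rw [minValue, hJ, ← ha, WithTop.coe_add]

/-- The real value of `minValue`. -/
noncomputable def minReal (v : Fin n → ℝ) (i : Fin n) : ℝ := (A.minValue v i).untopD 0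

variable {A}

theorem coe_minReal {i : Fin n} (h : (tensorSupport A i).Nonempty) (v : Fin n → ℝ) :
    (A.minReal v i : WithTop ℝ) = A.minValue v i := by
  obtain ⟨J, a, -, h⟩ := exists_minValue_eq h v
  rw [minReal, h, WithTop.untopD_coe]

theorem exists_minReal_eq {i : Fin n} (h : (tensorSupport A i).Nonempty) (v : Fin n → ℝ) :
    ∃ (J : Fin (m - 1) → Fin n) (a : ℝ), A i J = a ∧ A.minReal v i = a + ∑ k, v (J k) := by
  obtain ⟨J, a, ha, h⟩ := exists_minValue_eq h v
  exact ⟨J, a, ha, by rw [minReal, h, WithTop.untopD_coe]⟩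

theorem minReal_le {i : Fin n} (h : (tensorSupport A i).Nonempty) (v : Fin n → ℝ)
    {J : Fin (m - 1) → Fin n} {a : ℝ} (ha : A i J = a) : A.minReal v i ≤ a + ∑ k, v (J k) := by
  have := A.minValue_le v i J
  rwa [← coe_minReal h, ha, ← WithTop.coe_add, WithTop.coe_le_coe] at this

theorem hEigenEquations_iff (h : ∀ i, (tensorSupport A i).Nonempty) (v : Fin n → ℝ) (lam : ℝ) :
    HEigenEquations A v lam ↔ ∀ i, A.minReal v i = lam + ((m - 1 : ℕ) : ℝ) * v i := by
  refine forall_congr' fun i => ?_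
  have hprod : ∀ J : Fin (m - 1) → Fin n,
      ∏ k, tropReal (v (J k)) = tropReal (∑ k, v (J k)) := fun J => by
    rw [tropReal, WithTop.coe_sum, trop_sum]
  have hpow : tropReal (v i) ^ (m - 1) = tropReal (((m - 1 : ℕ) : ℝ) * v i) := by
    rw [tropReal, ← Tropical.trop_nsmul, ← nsmul_eq_mul]
    rfl
  have hsum : ∑ J : Fin (m - 1) → Fin n, Tropical.trop (A i J) * ∏ k, tropReal (v (J k)) =
      Tropical.trop (A.minValue v i) := by
    simp only [hprod]
    exact (Finset.trop_inf _ _).symm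
  rw [hsum, hpow, ← coe_minReal (h i), tropReal, tropReal, ← Tropical.trop_add,
    Tropical.trop_injective.eq_iff, ← WithTop.coe_add, WithTop.coe_inj]

theorem minReal_le_add {i : Fin n} (h : (tensorSupport A i).Nonempty) {v w : Fin n → ℝ} {c : ℝ}
    (hvw : ∀ j, v j ≤ w j + c) : A.minReal v i ≤ A.minReal w i + ((m - 1 : ℕ) : ℝ) * c := by
  obtain ⟨J, a, ha, hw⟩ := exists_minReal_eq h w
  have hs : ∑ k, v (J k) ≤ ∑ k, (w (J k) + c) := Finset.sum_le_sum fun k _ => hvw (J k)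
  rw [Finset.sum_add_distrib, Finset.sum_const, Finset.card_univ, Fintype.card_fin,
    nsmul_eq_mul] at hs
  linarith [minReal_le h v ha]

/-- A minimising tuple for row j has a rearrangement with finite entry in row i. Both have the same
v-sum, so only two tensor entries differ. -/
theorem exists_minReal_oscillation_le (h : ∀ i, (tensorSupport A i).Nonempty)
    (heq : ∀ i j, tensorSupport A i = tensorSupport A j) :
    ∃ C : ℝ, ∀ v i j, A.minReal v i ≤ A.minReal v j + C := by
  -- C bounds all finite entries; infinite ones count as 0.
  obtain ⟨C, hC⟩ : ∃ C : ℝ, ∀ p : Fin n × (Fin (m - 1) → Fin n),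
      |(A p.1 p.2).untopD 0| ≤ C := by
    obtain ⟨C, hC⟩ := (Set.finite_range fun p : Fin n × (Fin (m - 1) → Fin n) =>
      |(A p.1 p.2).untopD 0|).bddAbove
    exact ⟨C, fun p => hC ⟨p, rfl⟩⟩
  refine ⟨2 * C, fun v i j => ?_⟩
  obtain ⟨J, a, ha, hv⟩ := exists_minReal_eq (h j) v
  have hmem : Finset.univ.val.map J ∈ tensorSupport A j :=
    ⟨J, by rw [ha]; exact WithTop.coe_ne_top, rfl⟩
  rw [heq j i] at hmem
  obtain ⟨J', hJ', hM⟩ := hmem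
  obtain ⟨b, hb⟩ := WithTop.ne_top_iff_exists.1 hJ'
  have hsum : ∑ k, v (J k) = ∑ k, v (J' k) := by
    have := congrArg (fun M => (M.map v).sum) hM
    simpa only [Multiset.map_map, Finset.sum, Function.comp_def] using this
  have h₁ := hC (j, J)
  have h₂ := hC (i, J')
  simp only [ha, ← hb, WithTop.untopD_coe, abs_le] at h₁ h₂
  linarith [minReal_le (h i) v hb.symm, h₁.1, h₂.2]

theorem isTropicalHEigenvalue_iff (h : ∀ i, (tensorSupport A i).Nonempty) (lam : ℝ) :
    IsTropicalHEigenvalue A lam ↔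
      ∃ v : Fin n → ℝ, ∀ i, A.minReal v i = lam + ((m - 1 : ℕ) : ℝ) * v i := by
  constructor
  · rintro ⟨x, hx⟩
    induction x using Quotient.inductionOn' with
    | h v => exact ⟨v, (hEigenEquations_iff h v lam).1 hx⟩
  · rintro ⟨v, hv⟩
    exact ⟨Submodule.Quotient.mk v, (hEigenEquations_iff h v lam).2 hv⟩

end ExtTensor

theorem mainTheorem1 (m n : ℕ) (hm : 2 ≤ m) (hn : 1 ≤ n) (A : ExtTensor m n)
    (hne : ∀ i : Fin n, (tensorSupport A i).Nonempty)
    (heq : ∀ i j : Fin n, tensorSupport A i = tensorSupport A j) :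
    ∃! lam : ℝ, IsTropicalHEigenvalue A lam := by
  have : Nonempty (Fin n) := ⟨⟨0, hn⟩⟩
  have hd : 0 < ((m - 1 : ℕ) : ℝ) := Nat.cast_pos.2 (by omega)
  have hF : ∀ (v w : Fin n → ℝ) (c : ℝ), (∀ i, v i ≤ w i + c) →
      ∀ i, A.minReal v i ≤ A.minReal w i + ((m - 1 : ℕ) : ℝ) * c :=
    fun v w c hvw i => ExtTensor.minReal_le_add (hne i) hvw
  simp only [ExtTensor.isTropicalHEigenvalue_iff hne]
  refine existsUnique_of_exists_of_unique ?_ ?_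
  · obtain ⟨C, hC⟩ := ExtTensor.exists_minReal_oscillation_le hne heq
    obtain ⟨lam, v, hv⟩ := exists_additive_eigenvector
      (fun v i => A.minReal v i / ((m - 1 : ℕ) : ℝ))
      (fun v w c hvw i => by
        rw [div_le_iff₀ hd, add_mul, div_mul_cancel₀ _ hd.ne', mul_comm c]
        exact hF v w c hvw i)
      (C / ((m - 1 : ℕ) : ℝ))
      (fun v i j => by
        rw [← add_div]
        exact div_le_div_of_nonneg_right (hC v i j) hd.le)
    refine ⟨((m - 1 : ℕ) : ℝ) * lam, v, fun i => ?_⟩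
    rw [← mul_add, ← hv i, mul_div_cancel₀ _ hd.ne']
  · rintro lam mu ⟨v, hv⟩ ⟨w, hw⟩
    exact le_antisymm (additive_eigenvalue_le _ hF hv hw) (additive_eigenvalue_le _ hF hw hv)
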